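/- Let $K$ be a field with $\operatorname{char} K\neq 2,3$. Let $F$ be the free group freely generated by the variables $x_0,x_1,x_2,\dots$ and $y_1,y_2,\dots$. An element $u\in KF$ is an *identity* of a representation $\rho:G\to\operatorname{Aut}_K V$ if, for every substitution of elements of $G$ for the variables, the resulting element of $KG$ annihilates $V$. A set $U\subseteq KF$ is a *basis of identities* of a representation $\rho_0$ if all elements of $U$ are identities of $\rho_0$ and the variety defined by $U$ (the class of all representations over $K$ for which all elements of $U$ are identities) coincides with the variety generated by $\rho_0$ (the class of all representations over $K$ satisfying all identities of $\rho_0$). For a disjunction $\delta=(f_1=1)\vee\dots\vee(f_n=1)$ of equations, where $f_1,\dots,f_n$ are words in the variables $x_i$ and an equation $a=b$ is read as $ab^{-1}=1$, put $$\delta^*=(f_1^{y_1}-1)(f_2^{y_2}-1)\cdots(f_n^{y_n}-1)\in KF,\qquad f^{y}=y^{-1}fy .$$ Write $a\in\langle b\rangle$ for the disjunction $(a=1)\vee(a=b)\vee(a=b^2)\vee(a=b^3)$, write $[a,b]=a^{-1}b^{-1}ab$, and put $$\omega_{24}=\bigvee_{0\le i<j\le 24}(x_i=x_j),$$ $$\theta=\Big[\bigvee_{\substack{1\le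 i,j\le 3\\ i\ne j}}x_i\in\langle x_j\rangle\Big]\vee\Big[\bigvee_{\sigma\in S_3}x_{\sigma(1)}\in\langle x_{\sigma(2)}x_{\sigma(3)}\rangle\Big]\vee\Big[\bigvee_{\sigma\in S_3}x_{\sigma(1)}x_{\sigma(2)}\in\langle x_{\sigma(2)}x_{\sigma(3)}\rangle\Big],$$ $$\delta_{10}=(x_1^4=1)\vee(x_2^4=1)\vee((x_1x_2)^4=1)\vee((x_1x_2^2)^4=1),$$ $$\delta_{11}=(x_1^3=1)\vee(x_1^4=1),$$ $$\delta_{12}=(x_1^6=1)\vee(x_2^6=1)\vee(x_1=x_2)\vee(x_1x_2=1)\vee((x_1x_2)^3=1),$$ $$\delta_{13}=(x_1^3=1)\vee(x_2^3=1)\vee(x_3^3=1)\vee((x_1^{-1}x_2)^3=1)\vee((x_1^{-1}x_3)^3=1)\vee((x_2^{-1}x_3)^3=1)\vee\theta,$$ where indexed disjunctions are taken in the lexicographic order of $(i,j)$, respectively of $(\sigma(1),\sigma(2),\sigma(3))$. Then the elements $$\omega_{24}^*,\quad \delta_{10}^*,\quad \delta_{11}^*,\quad \delta_{12}^*,\quad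 \delta_{13}^*,\quad x_1^{12}-1,\quad [[[x_1,x_2],[x_3,x_4]],[[x_5,x_6],[x_7,x_8]]]-1$$ of $KF$ form a basis of identities of the regular representation $\operatorname{Reg}_K S_4=(KS_4,S_4)$ of the symmetric group $S_4$ over $K$. -/

import Mathlib

universe u v w u₀ v₀

namespace RegIdentities

/-- The free group `F` of countable rank. Its free generators are split into two infinite
sequences: the variables `x i` and the auxiliary variables `y k`. -/
abbrev F : Type := FreeGroup (ℕ ⊕ ℕ)

/-- The variable `x_i`. -/
def x (i : ℕ) : F := FreeGroup.of (Sum.inl i)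

/-- The auxiliary variable `y_k`. -/
def y (k : ℕ) : F := FreeGroup.of (Sum.inr k)

section Identities

variable {K : Type w} [Field K]

/-- `u ∈ KF` is an identity of the representation `ρ` of `G` on `V`: for every substitution `g`
of elements of `G` for the variables, the resulting element of `KG` annihilates `V`. -/
def IsIdentity {G : Type*} {V : Type*} [Group G] [AddCommGroup V] [Module K V]
    (ρ : Representation K G V) (p : MonoidAlgebra K F) : Prop :=
  ∀ g : ℕ ⊕ ℕ → G,
    ρ.asAlgebraHom (MonoidAlgebra.mapDomainAlgHom K K (FreeGroup.lift g) p) = 0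

/-- The set of all identities of a representation. -/
def identities {G : Type*} {V : Type*} [Group G] [AddCommGroup V] [Module K V]
    (ρ : Representation K G V) : Set (MonoidAlgebra K F) :=
  {p | IsIdentity ρ p}

/-- `ρ` belongs to the variety of representations defined by the set of identities `U`. -/
def InVariety (U : Set (MonoidAlgebra K F)) {G : Type*} {V : Type*} [Group G] [AddCommGroup V]
    [Module K V] (ρ : Representation K G V) : Prop :=
  ∀ p ∈ U, IsIdentity ρ p

/-- `U` is a basis of identities of `ρ₀`: the elements of `U` are identities of `ρ₀`, and the
variety defined by `U` is the variety generated by `ρ₀`, which is the class of all representations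
that satisfy all the identities of `ρ₀`. The groups range over `Type u`, the
spaces over `Type v`. -/
def IsBasisOfIdentities (U : Set (MonoidAlgebra K F)) {G₀ : Type u₀} {V₀ : Type v₀} [Group G₀]
    [AddCommGroup V₀] [Module K V₀] (ρ₀ : Representation K G₀ V₀) : Prop :=
  U ⊆ identities ρ₀ ∧
    ∀ (G : Type u) (V : Type v) [Group G] [AddCommGroup V] [Module K V]
      (ρ : Representation K G V),
      InVariety U ρ ↔ InVariety (identities ρ₀) ρ

variable (K) in
/-- The element `f - 1` of `KF`, for `f ∈ F`. -/
noncomputable def subOne (f : F) : MonoidAlgebra K F := MonoidAlgebra.of K F f - 1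

variable (K) in
/-- For the disjunctive identity `δ = (f_1 = 1) ∨ ... ∨ (f_n = 1)`, given as the list
`[f_1, ..., f_n]` of words in the variables `x i`, the element
`δ* = (f_1^{y_1} - 1) ... (f_n^{y_n} - 1)` of `KF`, where `f^y = y⁻¹ f y`. -/
noncomputable def starElem (δ : List F) : MonoidAlgebra K F :=
  (δ.mapIdx fun k f => subOne K ((y k)⁻¹ * f * y k)).prod

end Identities

/-! Disjunctive identities, as lists of words. An equation `a = b` is the word `a * b⁻¹`. -/

/-- `ω_n`: the disjunction of all `x_i = x_j` with `0 ≤ i < j ≤ n`. -/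
def omega (n : ℕ) : List F :=
  (List.range (n + 1)).flatMap fun i =>
    ((List.range (n + 1)).filter (i < ·)).map fun j => x i * (x j)⁻¹

/-- `a ∈ ⟨b⟩`, that is, `(a = 1) ∨ (a = b) ∨ (a = b²) ∨ (a = b³)`. -/
def memPowers (a b : F) : List F :=
  [a, a * b⁻¹, a * (b ^ 2)⁻¹, a * (b ^ 3)⁻¹]

/-- The ordered pairs `(i, j)` with `i ≠ j` in `{1, 2, 3}`. -/
def pairs : List (ℕ × ℕ) :=
  [(1, 2), (1, 3), (2, 1), (2, 3), (3, 1), (3, 2)]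

/-- The triples `(σ 1, σ 2, σ 3)` with `σ ∈ S_3`. -/
def triples : List (ℕ × ℕ × ℕ) :=
  [(1, 2, 3), (1, 3, 2), (2, 1, 3), (2, 3, 1), (3, 1, 2), (3, 2, 1)]

/-- `[⋁_{i ≠ j} x_i ∈ ⟨x_j⟩] ∨ [⋁_σ x_{σ(1)} ∈ ⟨x_{σ(2)} x_{σ(3)}⟩]
∨ [⋁_σ x_{σ(1)} x_{σ(2)} ∈ ⟨x_{σ(2)} x_{σ(3)}⟩]`. -/
def theta : List F :=
  (pairs.flatMap fun (i, j) => memPowers (x i) (x j)) ++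
  (triples.flatMap fun (i, j, k) => memPowers (x i) (x j * x k)) ++
  (triples.flatMap fun (i, j, k) => memPowers (x i * x j) (x j * x k))

/-- `(x_1^4 = 1) ∨ (x_2^4 = 1) ∨ ((x_1 x_2)^4 = 1) ∨ ((x_1 x_2^2)^4 = 1)`. -/
def delta10 : List F :=
  [x 1 ^ 4, x 2 ^ 4, (x 1 * x 2) ^ 4, (x 1 * x 2 ^ 2) ^ 4]

/-- `(x^3 = 1) ∨ (x^4 = 1)`. -/
def delta11 : List F :=
  [x 1 ^ 3, x 1 ^ 4]

/-- `(x_1^6 = 1) ∨ (x_2^6 = 1) ∨ (x_1 = x_2) ∨ (x_1 x_2 = 1) ∨ ((x_1 x_2)^3 = 1)`. -/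
def delta12 : List F :=
  [x 1 ^ 6, x 2 ^ 6, x 1 * (x 2)⁻¹, x 1 * x 2, (x 1 * x 2) ^ 3]

/-- `(x_1^3 = 1) ∨ (x_2^3 = 1) ∨ (x_3^3 = 1) ∨ ((x_1⁻¹ x_2)^3 = 1) ∨ ((x_1⁻¹ x_3)^3 = 1)
∨ ((x_2⁻¹ x_3)^3 = 1) ∨ θ`. -/
def delta13 : List F :=
  [x 1 ^ 3, x 2 ^ 3, x 3 ^ 3,
    ((x 1)⁻¹ * x 2) ^ 3, ((x 1)⁻¹ * x 3) ^ 3, ((x 2)⁻¹ * x 3) ^ 3] ++ theta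

/-- The commutator `[a, b] = a⁻¹ b⁻¹ a b`. -/
def comm (a b : F) : F := a⁻¹ * b⁻¹ * a * b

/-- The word `[[[x_1, x_2], [x_3, x_4]], [[x_5, x_6], [x_7, x_8]]]`. -/
def solvWord : F :=
  comm (comm (comm (x 1) (x 2)) (comm (x 3) (x 4)))
    (comm (comm (x 5) (x 6)) (comm (x 7) (x 8)))

/-- The elements `ω_24*`, the four `δ*`, `x^12 - 1`, and the `3`-solvability identity. -/
noncomputable def basisS4 (K : Type w) [Field K] : Set (MonoidAlgebra K F) :=
  {starElem K (omega 24), starElem K delta10, starElem K delta11, starElem K delta12, starElem K delta13,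
    subOne K (x 1 ^ 12), subOne K solvWord}

end RegIdentities

/-! That the listed elements are identities of the regular representation is a finite check in
`S_4`, since one trivial factor kills `δ*`. Conversely, let `ρ` satisfy them and let `p` be an
identity of the regular representation. A substitution into `p` involves only a finitely generated
group of operators. That group has exponent dividing 12 and is solvable, hence is finite
(`finite_of_fg_of_derivedSeries_eq_bot`). Its order is invertible in `K`, so Maschke's theorem
reduces to irreducible representations, and passing to the image makes them faithful.

On a faithful irreducible representation, `δ*` can vanish identically only if the group satisfies
the disjunction `δ` (`satisfies_of_isIdentity_starElem`): the independent conjugators `y_k` force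
some factor to be zero. The five disjunctions then force the group to embed in `S_4`
(`exists_embedding_of_satisfies`), and identities of a regular representation hold in every
representation of a subgroup (`IsIdentity.of_injective`). -/

namespace RegIdentities

/-! ### Finite groups satisfying the disjunctive identities embed in `S_4` -/

section Classification

variable {Q : Type*} [Group Q]

/-- A finite group acting faithfully on at most four cosets embeds in `S_4`. -/
theorem exists_embedding_of_normalCore_eq_bot [Finite Q] (H : Subgroup Q)
    (hcore : H.normalCore = ⊥) (hidx : H.index ≤ 4) :
    ∃ f : Q →* Equiv.Perm (Fin 4), Function.Injective f := by
  have hfin : Fintype (Q ⧸ H) := Fintype.ofFinite _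
  have hcard : Fintype.card (Q ⧸ H) ≤ Fintype.card (Fin 4) := by
    rw [Fintype.card_eq_nat_card, Fintype.card_fin]
    exact hidx
  obtain ⟨e⟩ := Function.Embedding.nonempty_of_card_le hcard
  refine ⟨(Equiv.Perm.viaEmbeddingHom e).comp (MulAction.toPermHom Q (Q ⧸ H)), ?_⟩
  refine (Equiv.Perm.viaEmbeddingHom_injective e).comp ?_
  rw [← MonoidHom.ker_eq_bot_iff, ← Subgroup.normalCore_eq_ker, hcore]

/-- A group of order at most eight with a non-central involution embeds in `S_4`. -/
theorem exists_embedding_of_involution [Finite Q] (t c : Q) (ht : t ^ 2 = 1)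
    (hc : c * t ≠ t * c) (hcard : Nat.card Q ≤ 8) :
    ∃ f : Q →* Equiv.Perm (Fin 4), Function.Injective f := by
  have ht1 : t ≠ 1 := by rintro rfl; simp at hc
  have hord : orderOf t = 2 := orderOf_eq_prime ht ht1
  have hmem : ∀ g ∈ Subgroup.zpowers t, g = 1 ∨ g = t := by
    intro g hg
    obtain ⟨k, rfl⟩ := Subgroup.mem_zpowers_iff.1 hg
    have h2 : t ^ (2 : ℤ) = 1 := by exact_mod_cast ht
    rcases Int.even_or_odd' k with ⟨m, rfl | rfl⟩ <;> simp [zpow_add, zpow_mul, h2]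
  refine exists_embedding_of_normalCore_eq_bot (Subgroup.zpowers t) ?_ ?_
  · rw [eq_bot_iff]
    intro g hg
    have hconj : ∀ b, b * g * b⁻¹ ∈ Subgroup.zpowers t := hg
    rcases hmem g (by simpa using hconj 1) with h | rfl
    · exact h
    · exfalso
      rcases hmem _ (hconj c) with h | h
      · apply ht1
        simpa using h
      · exact hc (by rw [← mul_inv_eq_iff_eq_mul]; exact h)
  · have h := (Subgroup.zpowers t).card_mul_index
    rw [Nat.card_zpowers, hord] at h
    omega

theorem exists_embedding_of_card_le_four [Finite Q] (hcard : Nat.card Q ≤ 4) :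
    ∃ f : Q →* Equiv.Perm (Fin 4), Function.Injective f := by
  refine exists_embedding_of_normalCore_eq_bot ⊥ ?_ ?_
  · exact eq_bot_iff.2 (Subgroup.normalCore_le _)
  · simpa using hcard

/-- A subgroup containing all products of two elements outside it has index at most two. -/
theorem index_le_two_of_mul_mem {H : Subgroup Q}
    (hmul : ∀ s t, s ∉ H → t ∉ H → s * t ∈ H) : H.index ≤ 2 := by
  by_cases htop : ∃ s, s ∉ H
  · obtain ⟨s, hs⟩ := htop
    refine (Subgroup.index_eq_two_iff.2 ⟨s, fun b => ?_⟩).le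
    by_cases hb : b ∈ H
    · exact Or.inr ⟨hb, fun h => hs ((Subgroup.mul_mem_cancel_left _ hb).1 h)⟩
    · exact Or.inl ⟨hmul b s hb hs, hb⟩
  · push Not at htop
    rw [(Subgroup.eq_top_iff' _).2 htop]
    simp

/-- If elements of order four generate the same cyclic subgroup and one exists, the group is
cyclic of order four or dihedral of order eight. -/
theorem exists_embedding_of_order_four [Finite Q] (h4 : ∀ a : Q, a ^ 4 = 1)
    (huniq : ∀ a b : Q, a ^ 2 = 1 ∨ b ^ 2 = 1 ∨ a = b ∨ a * b = 1) (x : Q) (hx : x ^ 2 ≠ 1) :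
    ∃ f : Q →* Equiv.Perm (Fin 4), Function.Injective f := by
  classical
  have hord : orderOf x = 4 := orderOf_eq_prime_pow (p := 2) (n := 1) (by simpa using hx) (h4 x)
  have hout : ∀ t, t ∉ Subgroup.zpowers x → t ^ 2 = 1 := by
    intro t ht
    rcases huniq x t with h | h | h | h
    · exact absurd h hx
    · exact h
    · exact absurd (h ▸ Subgroup.mem_zpowers x) ht
    · exact absurd (by rw [eq_inv_of_mul_eq_one_right h]; exact inv_mem (Subgroup.mem_zpowers x)) ht
  -- Both `t` and `t * x` lie outside `⟨x⟩`, so both square to one; hence `t` inverts `x`.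
  have hinv : ∀ t, t ∉ Subgroup.zpowers x → t * x * t⁻¹ = x⁻¹ := by
    intro t ht
    have h1 := hout t ht
    have h2 := hout (t * x) (fun h => ht ((Subgroup.mul_mem_cancel_right _
      (Subgroup.mem_zpowers x)).1 h))
    rw [inv_eq_of_mul_eq_one_left (a := t) (by rwa [← pow_two])]
    rw [eq_inv_iff_mul_eq_one]
    rw [← h2, pow_two, mul_assoc (t * x)]
  have hxx : x⁻¹ ≠ x := fun h => hx (by rw [pow_two]; nth_rewrite 1 [← h]; simp)
  -- Two elements inverting `x` have a product centralizing `x`, whereas anything outside `⟨x⟩`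
  -- inverts it, and `x⁻¹ ≠ x`.
  have hmul : ∀ s t, s ∉ Subgroup.zpowers x → t ∉ Subgroup.zpowers x →
      s * t ∈ Subgroup.zpowers x := by
    intro s t hs ht
    by_contra hst
    have h := hinv _ hst
    have : s * t * x * (s * t)⁻¹ = x := by
      calc s * t * x * (s * t)⁻¹ = s * (t * x * t⁻¹) * s⁻¹ := by group
        _ = (s * x * s⁻¹)⁻¹ := by rw [hinv t ht]; group
        _ = x := by rw [hinv s hs, inv_inv]
    exact hxx (h.symm.trans this)
  have hcardx : Nat.card (Subgroup.zpowers x) = 4 := by rw [Nat.card_zpowers, hord]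
  have hidx : (Subgroup.zpowers x).index ≤ 2 := index_le_two_of_mul_mem hmul
  have hcard := (Subgroup.zpowers x).card_mul_index
  rw [hcardx] at hcard
  by_cases htop : ∃ s, s ∉ Subgroup.zpowers x
  · obtain ⟨s, hs⟩ := htop
    refine exists_embedding_of_involution s x (hout s hs) (fun h => hxx ?_) (by omega)
    rw [← hinv s hs, ← h, mul_inv_cancel_right]
  · push Not at htop
    refine exists_embedding_of_card_le_four ?_
    rw [← hcardx, (Subgroup.eq_top_iff' _).2 htop]
    simp

/-- In a group where every element has order dividing `3` or `4` and which
contains no independent pair of elements of order three, an element of order three is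
self-centralizing. -/
theorem mem_zpowers_of_commute (h10 : ∀ a b : Q, a ^ 4 = 1 ∨ b ^ 4 = 1 ∨ (a * b) ^ 4 = 1 ∨
      (a * b ^ 2) ^ 4 = 1) (h11 : ∀ a : Q, a ^ 3 = 1 ∨ a ^ 4 = 1)
    {c : Q} (hc3 : c ^ 3 = 1) (hc : c ≠ 1) {g : Q} (hg : Commute g c) :
    g ∈ Subgroup.zpowers c := by
  by_contra hmem
  have hg1 : g ≠ 1 := by rintro rfl; exact hmem (one_mem _)
  have four : ∀ a : Q, a ^ 3 = 1 → a ^ 4 = a := fun a ha => by rw [pow_succ, ha, one_mul]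
  -- If `g ^ 3 = 1`, then `c`, `g`, `c * g`, `c * g ^ 2` all equal their fourth powers, so `h10`
  -- makes one of them trivial. If `g ^ 4 = 1`, then `g * c` has cube `g ^ 3` and fourth power `c`,
  -- and neither can be trivial.
  rcases h11 g with h3 | h4
  · have hp : ∀ k : ℕ, (c * g ^ k) ^ 4 = c * g ^ k := fun k =>
      four _ (by rw [((hg.symm).pow_right k).mul_pow, hc3, ← pow_mul, mul_comm k, pow_mul, h3]; simp)
    rcases h10 c g with h | h | h | h
    · exact hc (four c hc3 ▸ h)
    · exact hg1 (four g h3 ▸ h)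
    · have := hp 1
      rw [pow_one] at this
      rw [this] at h
      exact hmem (by rw [eq_inv_of_mul_eq_one_right h]; exact inv_mem (Subgroup.mem_zpowers c))
    · rw [hp 2] at h
      have : g = c := by
        have h2 : g ^ 2 * g = 1 := by rw [← pow_succ, h3]
        rw [eq_inv_of_mul_eq_one_right h2, inv_eq_of_mul_eq_one_left h]
      exact hmem (this ▸ Subgroup.mem_zpowers c)
  · rcases h11 (g * c) with h | h
    · rw [hg.mul_pow, hc3, mul_one] at h
      apply hg1
      rw [pow_succ, h, one_mul] at h4
      exact h4
    · rw [hg.mul_pow, h4, one_mul, four c hc3] at h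
      exact hc h

/-- Conjugation by an element normalizing a subgroup of order three fixes or inverts its
generator. -/
theorem conj_eq_or_eq_inv {c : Q} (hc3 : c ^ 3 = 1) (hc : c ≠ 1) {g : Q}
    (hg : g * c * g⁻¹ ∈ Subgroup.zpowers c) : g * c * g⁻¹ = c ∨ g * c * g⁻¹ = c⁻¹ := by
  obtain ⟨k, hk⟩ := Subgroup.mem_zpowers_iff.1 hg
  have h3 : c ^ (3 : ℤ) = 1 := by exact_mod_cast hc3
  obtain ⟨m, hm⟩ : ∃ m, k = 3 * m ∨ k = 3 * m + 1 ∨ k = 3 * m + -1 := ⟨(k + 1) / 3, by omega⟩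
  rw [← hk]
  rcases hm with rfl | rfl | rfl
  · exfalso
    rw [zpow_mul, h3, one_zpow] at hk
    exact hc (conj_eq_one_iff.1 hk.symm)
  · left; rw [zpow_add, zpow_mul, h3, one_zpow, one_mul, zpow_one]
  · right; rw [zpow_add, zpow_mul, h3, one_zpow, one_mul, zpow_neg_one]

/-- Since `⟨c⟩` is a self-centralizing Sylow subgroup, its normalizer `N` has order 3 or 6. Either
`N` is core-free and the action on its at most four cosets is faithful, or `⟨c⟩` is normal and `Q`
itself has order 3 or 6. -/
theorem exists_embedding_of_order_three [Finite Q] (hcard : Nat.card Q ≤ 24)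
    (h10 : ∀ a b : Q, a ^ 4 = 1 ∨ b ^ 4 = 1 ∨ (a * b) ^ 4 = 1 ∨ (a * b ^ 2) ^ 4 = 1)
    (h11 : ∀ a : Q, a ^ 3 = 1 ∨ a ^ 4 = 1) (c : Q) (hc3 : c ^ 3 = 1) (hc : c ≠ 1) :
    ∃ f : Q →* Equiv.Perm (Fin 4), Function.Injective f := by
  have hord : orderOf c = 3 := orderOf_eq_prime hc3 hc
  have hcardP : Nat.card (Subgroup.zpowers c) = 3 := by rw [Nat.card_zpowers, hord]
  have hcP := Subgroup.mem_zpowers c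
  have hcinv : c⁻¹ ≠ c := by
    intro h
    apply hc
    have : c * c = 1 := by nth_rewrite 1 [← h]; simp
    rw [← hc3, pow_succ, pow_two, this, one_mul]
  have hcomm : ∀ g : Q, g * c * g⁻¹ = c → g ∈ Subgroup.zpowers c := fun g hg =>
    mem_zpowers_of_commute h10 h11 hc3 hc (mul_inv_eq_iff_eq_mul.1 hg)
  -- `⟨c⟩` is a Sylow `3`-subgroup
  have : Fact (Nat.Prime 3) := ⟨Nat.prime_three⟩
  obtain ⟨S, hS⟩ : ∃ S : Sylow 3 Q, (S : Subgroup Q) = Subgroup.zpowers c := by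
    have hp : IsPGroup 3 (Subgroup.zpowers c) := IsPGroup.of_card (n := 1) (by rw [hcardP]; rfl)
    obtain ⟨S, hle⟩ := hp.exists_le_sylow
    refine ⟨S, ?_⟩
    have : Nontrivial (S : Subgroup Q) := by
      refine Subgroup.nontrivial_iff_ne_bot _ |>.2 fun h => hc ?_
      have := hle hcP
      rwa [h, Subgroup.mem_bot] at this
    have := S.isPGroup'.center_nontrivial
    -- A nontrivial central `z` has order 3, and all of `S` commutes with it; self-centralization
    -- gives `S ≤ ⟨z⟩`, so `S` has order 3.
    obtain ⟨⟨z, hz⟩, hz1⟩ := exists_ne (1 : Subgroup.center (S : Subgroup Q))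
    have hzQ : (z : Q) ≠ 1 := fun h => hz1 (by ext; exact h)
    have hz3 : (z : Q) ^ 3 = 1 := by
      rcases h11 (z : Q) with h | h
      · exact h
      · exfalso
        obtain ⟨k, hk⟩ := S.isPGroup' z
        have hk' : (z : Q) ^ 3 ^ k = 1 := by exact_mod_cast congrArg Subtype.val hk
        have hd := Nat.dvd_gcd (orderOf_dvd_of_pow_eq_one hk') (orderOf_dvd_of_pow_eq_one h)
        have hco : Nat.Coprime (3 ^ k) 4 := Nat.Coprime.pow_left k (by norm_num)
        rw [hco, Nat.dvd_one, orderOf_eq_one_iff] at hd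
        exact hzQ hd
    have hSz : (S : Subgroup Q) ≤ Subgroup.zpowers (z : Q) := fun s hs =>
      mem_zpowers_of_commute h10 h11 hz3 hzQ
        (congrArg Subtype.val (Subgroup.mem_center_iff.1 hz ⟨s, hs⟩))
    refine (Subgroup.eq_of_le_of_card_ge hle ?_).symm
    rw [hcardP]
    refine (Subgroup.card_le_of_le hSz).trans ?_
    rw [Nat.card_zpowers, orderOf_eq_prime hz3 hzQ]
  set N : Subgroup Q := Subgroup.normalizer (S : Set Q) with hN
  have hPN : Subgroup.zpowers c ≤ N := by
    rw [← hS]; exact Subgroup.le_normalizer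
  have hconj : ∀ g ∈ N, g * c * g⁻¹ = c ∨ g * c * g⁻¹ = c⁻¹ := by
    intro g hg
    refine conj_eq_or_eq_inv hc3 hc ?_
    rw [← hS] at hcP ⊢
    exact (Subgroup.mem_normalizer_iff.1 hg c).1 hcP
  have hconj' : ∀ g ∈ N, g ∉ Subgroup.zpowers c → g * c * g⁻¹ = c⁻¹ := fun g hg hgP =>
    (hconj g hg).resolve_left fun h => hgP (hcomm g h)
  have hmul : ∀ s ∈ N, ∀ t ∈ N, s ∉ Subgroup.zpowers c → t ∉ Subgroup.zpowers c →
      s * t ∈ Subgroup.zpowers c := by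
    intro s hs t ht hs' ht'
    apply hcomm
    calc s * t * c * (s * t)⁻¹ = s * (t * c * t⁻¹) * s⁻¹ := by group
      _ = (s * c * s⁻¹)⁻¹ := by rw [hconj' t ht ht']; group
      _ = c := by rw [hconj' s hs hs', inv_inv]
  have hcube : ∀ g ∈ N, g ^ 3 = 1 → g ∈ Subgroup.zpowers c := by
    intro g hg hg3
    by_contra hgP
    have h2 := hmul g hg g hg hgP hgP
    have : g * g * g ∈ Subgroup.zpowers c := by
      rw [← pow_two, ← pow_succ, hg3]; exact one_mem _
    exact hgP ((Subgroup.mul_mem_cancel_left _ h2).1 this)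
  have hcardN : Nat.card N = 3 ∨ Nat.card N = 6 := by
    have hidx : ((Subgroup.zpowers c).subgroupOf N).index ≤ 2 := by
      refine index_le_two_of_mul_mem fun s t hs ht => ?_
      exact hmul s s.2 t t.2 hs ht
    have h0 : ((Subgroup.zpowers c).subgroupOf N).index ≠ 0 := Subgroup.index_ne_zero_of_finite
    have h := ((Subgroup.zpowers c).subgroupOf N).card_mul_index
    rw [Nat.card_congr (Subgroup.subgroupOfEquivOfLe hPN).toEquiv, hcardP] at h
    omega
  have hNcard := N.card_mul_index
  by_cases hcore : N.normalCore = ⊥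
  · refine exists_embedding_of_normalCore_eq_bot N hcore ?_
    have hmod := card_sylow_modEq_one 3 Q
    rw [Sylow.card_eq_index_normalizer S] at hmod
    change N.index % 3 = 1 % 3 at hmod
    -- The index is congruent to 1 mod 3, exceeds 4 and is at most `24 / 3 = 8`. So it is 7, and
    -- Cauchy's theorem gives an element of order 7, against `h11`.
    by_contra hlt
    have h7 : N.index = 7 := by
      rcases hcardN with h | h <;> rw [h] at hNcard <;> omega
    have : Fact (Nat.Prime 7) := ⟨by norm_num⟩
    obtain ⟨g, hg⟩ := exists_prime_orderOf_dvd_card' (G := Q) 7 (hNcard ▸ h7 ▸ dvd_mul_left _ _)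
    rcases h11 g with h | h <;> have := orderOf_dvd_of_pow_eq_one h <;> rw [hg] at this <;>
      revert this <;> decide
  · have hcM : c ∈ N.normalCore := by
      obtain ⟨⟨m, hm⟩, hm1⟩ := Subgroup.ne_bot_iff_exists_ne_one.1 hcore
      replace hm1 : m ≠ 1 := fun h => hm1 (Subtype.ext h)
      have hmN := Subgroup.normalCore_le N hm
      by_contra hcM
      have hmc : m * c * m⁻¹ * c⁻¹ ∈ N.normalCore := by
        rw [mul_assoc m, mul_assoc m]
        exact mul_mem hm ((Subgroup.normalCore_normal N).conj_mem _ (inv_mem hm) c)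
      -- If `m` centralizes `c`, it generates `⟨c⟩`. If it inverts `c`, the commutator `m * c * m⁻¹
      -- * c⁻¹` equals `c⁻¹ * c⁻¹ = c`. Either way the core contains `c`.
      rcases hconj m hmN with h | h
      · have hmP := hcomm m h
        have hm3 : m ^ 3 = 1 := by
          rw [← hord, ← orderOf_dvd_iff_pow_eq_one]
          exact orderOf_dvd_of_mem_zpowers hmP
        have : Subgroup.zpowers m = Subgroup.zpowers c := by
          refine Subgroup.eq_of_le_of_card_ge (by simpa using hmP) ?_
          rw [Nat.card_zpowers, Nat.card_zpowers, hord, orderOf_eq_prime hm3 hm1]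
        refine hcM ((?_ : Subgroup.zpowers c ≤ _) hcP)
        rw [← this]
        simpa using hm
      · apply hcM
        rw [h] at hmc
        convert hmc using 1
        rw [eq_mul_inv_iff_mul_eq, eq_inv_iff_mul_eq_one, ← pow_two, ← pow_succ, hc3]
    have hnormal : (Subgroup.zpowers c).Normal := by
      have h1 : ∀ q : Q, q * c * q⁻¹ ∈ Subgroup.zpowers c := by
        intro q
        have := (Subgroup.normalCore_normal N).conj_mem _ hcM q
        exact hcube _ (Subgroup.normalCore_le N this) (by rw [conj_pow, hc3]; simp)
      refine ⟨fun n hn q => ?_⟩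
      obtain ⟨k, rfl⟩ := Subgroup.mem_zpowers_iff.1 hn
      rw [← conj_zpow]
      exact zpow_mem (h1 q) k
    have htop : N = ⊤ := by
      change Subgroup.normalizer ((S : Subgroup Q) : Set Q) = ⊤
      rw [hS]
      exact Subgroup.normalizer_eq_top_iff.2 hnormal
    have hall : ∀ g : Q, g ∈ N := fun g => htop ▸ Subgroup.mem_top g
    rw [htop, Subgroup.card_top] at hcardN
    by_cases ht : ∃ t, t ∉ Subgroup.zpowers c
    · obtain ⟨t, ht⟩ := ht
      have ht4 : t ^ 4 = 1 := (h11 t).resolve_left fun h => ht (hcube t (hall t) h)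
      have ht6 : t ^ 6 = 1 := by
        rw [show 6 = 2 * 3 from rfl, pow_mul, ← hord, ← orderOf_dvd_iff_pow_eq_one, pow_two]
        exact orderOf_dvd_of_mem_zpowers (hmul t (hall t) t (hall t) ht ht)
      have ht2 : t ^ 2 = 1 := by
        rwa [show 6 = 4 + 2 from rfl, pow_add, ht4, one_mul] at ht6
      refine exists_embedding_of_involution t c ht2 (fun h => hcinv ?_) (by omega)
      rw [← hconj' t (hall t) ht, ← h, mul_inv_cancel_right]
    · push Not at ht
      refine exists_embedding_of_card_le_four ?_
      have := hcardP
      rw [(Subgroup.eq_top_iff' _).2 ht, Subgroup.card_top] at this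
      omega

/-- `Q` satisfies the disjunctive identity `δ`. -/
def Satisfies (δ : List F) (Q : Type*) [Group Q] : Prop :=
  ∀ g : ℕ ⊕ ℕ → Q, ∃ f ∈ δ, FreeGroup.lift g f = 1

/-- Such a group is a vector space over the field with two elements. If its order exceeds 4, it has
three independent vectors, and these violate every disjunct of `delta13`: each would be a nontrivial
linear relation. -/
theorem card_le_four_of_sq_eq_one (hsq : ∀ a : Q, a ^ 2 = 1) (h13 : Satisfies delta13 Q) :
    Nat.card Q ≤ 4 := by
  by_contra! hlt
  have hmul : ∀ a : Q, a * a = 1 := fun a => by rw [← pow_two, hsq]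
  have hinv : ∀ a : Q, a⁻¹ = a := fun a => inv_eq_of_mul_eq_one_left (hmul a)
  have hcube : ∀ a : Q, a ^ 3 = a := fun a => by rw [pow_succ, hsq, one_mul]
  have hc : ∀ a b : Q, a * b = b * a := fun a b => by
    have := hinv (a * b)
    rw [mul_inv_rev, hinv, hinv] at this
    exact this.symm
  have hlc : ∀ a b c : Q, a * (b * c) = b * (a * c) := fun a b c => by
    rw [← mul_assoc, hc a b, mul_assoc]
  have hmm : ∀ a b : Q, a * (a * b) = b := fun a b => by rw [← mul_assoc, hmul, one_mul]
  have : Finite Q := Nat.finite_of_card_ne_zero (by omega)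
  have hex : ∀ s : Finset Q, s.card ≤ 4 → ∃ q, q ∉ s := by
    intro s hs
    by_contra! h
    have : Nat.card Q ≤ s.card := by
      have := Fintype.ofFinite Q
      rw [Nat.card_eq_fintype_card]
      exact Finset.card_le_card (fun q _ => h q)
    omega
  classical
  obtain ⟨a, ha⟩ := hex {1} (by simp)
  obtain ⟨b, hb⟩ := hex {1, a} (Finset.card_le_two.trans (by norm_num))
  obtain ⟨c, hcc⟩ := hex {1, a, b, a * b} Finset.card_le_four
  simp only [Finset.mem_insert, Finset.mem_singleton, not_or] at ha hb hcc
  have hb2 : a * b ≠ 1 := fun h => hb.2 (by rw [eq_inv_of_mul_eq_one_right h, hinv])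
  have hc2 : a * c ≠ 1 := fun h => hcc.2.1 (by rw [eq_inv_of_mul_eq_one_right h, hinv])
  have hc3 : b * c ≠ 1 := fun h => hcc.2.2.1 (by rw [eq_inv_of_mul_eq_one_right h, hinv])
  have hc4 : a * (b * c) ≠ 1 := fun h =>
    hcc.2.2.2 (by rw [← mul_assoc] at h; rw [eq_inv_of_mul_eq_one_right h, hinv])
  have hg : ∀ f ∈ delta13,
      FreeGroup.lift (Sum.elim (fun i => if i = 1 then a else if i = 2 then b else c) 1) f ≠ 1 := by
    simp only [delta13, theta, pairs, triples, memPowers, List.flatMap_cons, List.flatMap_nil,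
      List.cons_append, List.nil_append, List.forall_mem_cons, x, map_mul, map_inv, map_pow,
      FreeGroup.lift_apply_of, Sum.elim_inl, hsq, hcube, hinv, mul_assoc, mul_one]
    simp [hc b a, hc c a, hc c b, hlc b a, hlc c a, hlc c b, hmul, hmm, ha, hb, hcc, hb2, hc2,
      hc3, hc4]
  obtain ⟨f, hf, h⟩ := h13 (Sum.elim (fun i => if i = 1 then a else if i = 2 then b else c) 1)
  exact hg f hf h

theorem mem_omega {n : ℕ} {f : F} : f ∈ omega n ↔ ∃ i j, i < j ∧ j ≤ n ∧ x i * (x j)⁻¹ = f := by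
  simp only [omega, List.mem_flatMap, List.mem_map, List.mem_filter, List.mem_range,
    decide_eq_true_eq]
  constructor
  · rintro ⟨i, -, j, ⟨hj, hij⟩, rfl⟩
    exact ⟨i, j, hij, by omega, rfl⟩
  · rintro ⟨i, j, hij, hj, rfl⟩
    exact ⟨i, by omega, j, ⟨by omega, hij⟩, rfl⟩

/-- The disjunctive identity `ω_n` bounds the order of the group by `n`. -/
theorem satisfies_omega_iff [Finite Q] {n : ℕ} : Satisfies (omega n) Q ↔ Nat.card Q ≤ n := by
  have : Fintype Q := Fintype.ofFinite Q
  rw [Nat.card_eq_fintype_card]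
  constructor
  · intro h
    by_contra! hlt
    obtain ⟨e⟩ := Function.Embedding.nonempty_of_card_le (α := Fin (n + 1)) (β := Q) (by simpa)
    obtain ⟨f, hf, h1⟩ := h (Sum.elim (fun i => if hi : i < n + 1 then e ⟨i, hi⟩ else 1) 1)
    obtain ⟨i, j, hij, hj, rfl⟩ := mem_omega.1 hf
    simp only [x, map_mul, map_inv, FreeGroup.lift_apply_of, Sum.elim_inl,
      dif_pos (show i < n + 1 by omega), dif_pos (show j < n + 1 by omega)] at h1
    have := e.injective (mul_inv_eq_one.1 h1)
    simp only [Fin.mk.injEq] at this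
    omega
  · intro h g
    obtain ⟨i, j, hij, he⟩ := Fintype.exists_ne_map_eq_of_card_lt
      (fun i : Fin (n + 1) => g (Sum.inl i)) (by simp; omega)
    rcases lt_or_gt_of_ne hij with h | h
    · exact ⟨_, mem_omega.2 ⟨i, j, h, by omega, rfl⟩, by simp [x, he]⟩
    · exact ⟨_, mem_omega.2 ⟨j, i, h, by omega, rfl⟩, by simp [x, he]⟩

/-- A finite group satisfying the five disjunctive identities embeds in `S_4`. -/
theorem exists_embedding_of_satisfies [Finite Q] (h24 : Satisfies (omega 24) Q)
    (h10 : Satisfies delta10 Q) (h11 : Satisfies delta11 Q) (h12 : Satisfies delta12 Q)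
    (h13 : Satisfies delta13 Q) :
    ∃ f : Q →* Equiv.Perm (Fin 4), Function.Injective f := by
  have h10' : ∀ a b : Q, a ^ 4 = 1 ∨ b ^ 4 = 1 ∨ (a * b) ^ 4 = 1 ∨ (a * b ^ 2) ^ 4 = 1 := by
    intro a b
    simpa [delta10, x] using h10 (Sum.elim (fun i => if i = 1 then a else b) 1)
  have h11' : ∀ a : Q, a ^ 3 = 1 ∨ a ^ 4 = 1 := by
    intro a
    simpa [delta11, x] using h11 (fun _ => a)
  have h12' : ∀ a b : Q, a ^ 6 = 1 ∨ b ^ 6 = 1 ∨ a * b⁻¹ = 1 ∨ a * b = 1 ∨ (a * b) ^ 3 = 1 := by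
    intro a b
    simpa [delta12, x] using h12 (Sum.elim (fun i => if i = 1 then a else b) 1)
  by_cases hc : ∃ c : Q, c ^ 3 = 1 ∧ c ≠ 1
  · obtain ⟨c, hc3, hc⟩ := hc
    exact exists_embedding_of_order_three (satisfies_omega_iff.1 h24) h10' h11' c hc3 hc
  · push Not at hc
    -- Without elements of order 3 the exponent divides 4. Sixth powers are then squares and the
    -- last disjunct of `delta12` collapses to `a * b = 1`, which leaves the hypothesis of
    -- `exists_embedding_of_order_four`.
    have h4 : ∀ a : Q, a ^ 4 = 1 := fun a => (h11' a).elim (fun h => by simp [hc a h]) id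
    by_cases hx : ∃ a : Q, a ^ 2 ≠ 1
    · obtain ⟨a, ha⟩ := hx
      have h6 : ∀ a : Q, a ^ 6 = a ^ 2 := fun a => by
        rw [show 6 = 4 + 2 from rfl, pow_add, h4, one_mul]
      refine exists_embedding_of_order_four h4 (fun a b => ?_) a ha
      rcases h12' a b with h | h | h | h | h
      · exact Or.inl (h6 a ▸ h)
      · exact Or.inr (Or.inl (h6 b ▸ h))
      · exact Or.inr (Or.inr (Or.inl (mul_inv_eq_one.1 h)))
      · exact Or.inr (Or.inr (Or.inr h))
      · exact Or.inr (Or.inr (Or.inr (hc _ h)))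
    · push Not at hx
      exact exists_embedding_of_card_le_four (card_le_four_of_sq_eq_one hx h13)

end Classification

/-! ### `S_4` satisfies the disjunctive identities -/

section SymmetricGroup

open Equiv

theorem perm_satisfies_omega : Satisfies (omega 24) (Perm (Fin 4)) :=
  satisfies_omega_iff.2 (by rw [Nat.card_perm, Nat.card_fin]; rfl)

theorem perm_satisfies_delta10 : Satisfies delta10 (Perm (Fin 4)) := by
  have key : ∀ a b : Perm (Fin 4),
      a ^ 4 = 1 ∨ b ^ 4 = 1 ∨ (a * b) ^ 4 = 1 ∨ (a * b ^ 2) ^ 4 = 1 := by decide +kernel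
  intro g
  simpa [delta10, x] using key (g (Sum.inl 1)) (g (Sum.inl 2))

theorem perm_satisfies_delta11 : Satisfies delta11 (Perm (Fin 4)) := by
  have key : ∀ a : Perm (Fin 4), a ^ 3 = 1 ∨ a ^ 4 = 1 := by decide +kernel
  intro g
  simpa [delta11, x] using key (g (Sum.inl 1))

theorem perm_satisfies_delta12 : Satisfies delta12 (Perm (Fin 4)) := by
  have key : ∀ a b : Perm (Fin 4),
      a ^ 6 = 1 ∨ b ^ 6 = 1 ∨ a * b⁻¹ = 1 ∨ a * b = 1 ∨ (a * b) ^ 3 = 1 := by decide +kernel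
  intro g
  simpa [delta12, x] using key (g (Sum.inl 1)) (g (Sum.inl 2))

/-- The value of `memPowers` under a substitution. -/
theorem exists_mem_memPowers {Q : Type*} [Group Q] (φ : F →* Q) (a b : F) :
    (∃ f ∈ memPowers a b, φ f = 1) ↔
      φ a = 1 ∨ φ a = φ b ∨ φ a = φ b ^ 2 ∨ φ a = φ b ^ 3 := by
  simp [memPowers, mul_inv_eq_one]

theorem perm_satisfies_delta13 : Satisfies delta13 (Perm (Fin 4)) := by
  -- Each disjunct stands before the quantifiers it does not need, so the kernel prunes the search
  -- before enumerating further elements.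
  have key : ∀ a : Perm (Fin 4), a ^ 3 = 1 ∨ ∀ b, b ^ 3 = 1 ∨ (a⁻¹ * b) ^ 3 = 1 ∨
      ∀ c, c ^ 3 = 1 ∨ (a⁻¹ * c) ^ 3 = 1 ∨ (b⁻¹ * c) ^ 3 = 1 ∨
      ∃ p ∈ [(a, b), (a, c), (b, a), (b, c), (c, a), (c, b), (a, b * c), (a, c * b), (b, a * c),
        (b, c * a), (c, a * b), (c, b * a),
        (a * b, b * c), (a * c, c * b), (b * a, a * c), (b * c, c * a), (c * a, a * b),
        (c * b, b * a)],
        p.1 = 1 ∨ p.1 = p.2 ∨ p.1 = p.2 ^ 2 ∨ p.1 = p.2 ^ 3 := by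
    decide +kernel
  intro g
  simp only [delta13, theta, pairs, triples, List.flatMap_cons, List.flatMap_nil, List.mem_append,
    List.mem_cons, List.not_mem_nil, or_and_right, exists_or, exists_mem_memPowers,
    exists_eq_left, or_false]
  simp only [x, map_mul, map_inv, map_pow, FreeGroup.lift_apply_of]
  generalize g (Sum.inl 1) = a
  generalize g (Sum.inl 2) = b
  generalize g (Sum.inl 3) = c
  rcases key a with h | h
  · exact Or.inl (Or.inl h)
  rcases h b with h | h | h
  · exact Or.inl (Or.inr (Or.inl h))
  · exact Or.inl (Or.inr (Or.inr (Or.inr (Or.inl h))))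
  rcases h c with h | h | h | h
  · exact Or.inl (Or.inr (Or.inr (Or.inl h)))
  · exact Or.inl (Or.inr (Or.inr (Or.inr (Or.inr (Or.inl h)))))
  · exact Or.inl (Or.inr (Or.inr (Or.inr (Or.inr (Or.inr h)))))
  · simp only [List.mem_cons, List.not_mem_nil, or_and_right, exists_or, exists_eq_left,
      or_false] at h
    refine Or.inr ?_
    simpa only [or_assoc] using h

end SymmetricGroup

/-! ### Solvability and finiteness of finitely generated torsion groups -/

section FiniteGroups

variable {G : Type*} [Group G]

/-- The values of iterated commutator words: all of `G`, then all commutators of the previous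
values. -/
def commValues (G : Type*) [Group G] : ℕ → Set G
  | 0 => Set.univ
  | n + 1 => {g | ∃ a ∈ commValues G n, ∃ b ∈ commValues G n, a⁻¹ * b⁻¹ * a * b = g}

theorem conj_mem_commValues (n : ℕ) {a : G} (ha : a ∈ commValues G n) (g : G) :
    g * a * g⁻¹ ∈ commValues G n := by
  induction n generalizing a with
  | zero => trivial
  | succ n ih =>
    obtain ⟨b, hb, c, hc, rfl⟩ := ha
    exact ⟨_, ih hb, _, ih hc, by group⟩

theorem closure_normal_of_conj {A : Set G} (hA : ∀ a ∈ A, ∀ g : G, g * a * g⁻¹ ∈ A) :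
    (Subgroup.closure A).Normal := by
  refine ⟨fun n hn g => ?_⟩
  induction hn using Subgroup.closure_induction with
  | mem a ha => exact Subgroup.subset_closure (hA a ha g)
  | one => simp
  | mul a b _ _ iha ihb => rw [← conj_mul]; exact mul_mem iha ihb
  | inv a _ iha => rw [← conj_inv]; exact inv_mem iha

/-- This turns the single word `solvWord` into a statement about the derived series. Modulo the
normal closure of the next commutator values, the current values commute pairwise, so the subgroup
they generate becomes abelian. -/
theorem derivedSeries_le_closure_commValues (n : ℕ) :
    derivedSeries G n ≤ Subgroup.closure (commValues G n) := by
  induction n with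
  | zero => simp [commValues]
  | succ n ih =>
    have hN := closure_normal_of_conj fun a ha g => conj_mem_commValues (G := G) (n + 1) ha g
    set N := Subgroup.closure (commValues G (n + 1))
    have hcomm : ∀ a ∈ commValues G n, ∀ b ∈ commValues G n,
        (QuotientGroup.mk' N a) * QuotientGroup.mk' N b =
          QuotientGroup.mk' N b * QuotientGroup.mk' N a := by
      intro a ha b hb
      rw [← map_mul, ← map_mul, QuotientGroup.mk'_apply, QuotientGroup.mk'_apply, eq_comm,
        QuotientGroup.eq]
      exact Subgroup.subset_closure ⟨a, ha, b, hb, by group⟩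
    have h1 : Subgroup.closure (commValues G n) ≤ (Subgroup.centralizer
        (QuotientGroup.mk' N '' commValues G n)).comap (QuotientGroup.mk' N) := by
      rw [Subgroup.closure_le]
      rintro a ha _ ⟨b, hb, rfl⟩
      exact hcomm b hb a ha
    have h2 : Subgroup.closure (commValues G n) ≤ (Subgroup.centralizer
        (QuotientGroup.mk' N '' Subgroup.closure (commValues G n))).comap
          (QuotientGroup.mk' N) := by
      rw [Subgroup.closure_le]
      rintro a ha _ ⟨b, hb, rfl⟩
      exact (h1 hb _ ⟨a, ha, rfl⟩).symm
    rw [derivedSeries_succ, Subgroup.commutator_le]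
    intro a ha b hb
    rw [← QuotientGroup.ker_mk' N, MonoidHom.mem_ker, map_commutatorElement,
      commutatorElement_eq_one_iff_mul_comm]
    exact (h2 (ih ha) _ ⟨b, ih hb, rfl⟩).symm

/-- Finitely generated torsion groups have derived series terms of finite index. -/
theorem derivedSeries_finiteIndex [Group.FG G] (hG : IsMulTorsion G) (n : ℕ) :
    (derivedSeries G n).FiniteIndex := by
  induction n with
  | zero => rw [derivedSeries_zero]; infer_instance
  | succ n ih =>
    set D := derivedSeries G n
    -- By Schreier's lemma a finite-index subgroup stays finitely generated, so its abelianization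
    -- is a finitely generated torsion abelian group, hence finite.
    have : Group.FG D := D.fg_of_index_ne_zero
    have : Group.FG (Abelianization D) := QuotientGroup.fg _
    have hfin : Finite (Abelianization D) := by
      refine CommGroup.finite_of_fg_isMulTorsion _ ?_
      exact (hG.subgroup D).of_surjective (f := Abelianization.of) QuotientGroup.mk_surjective
    have hidx : (commutator D).FiniteIndex := Subgroup.finiteIndex_iff_finite_quotient.2 hfin
    rw [derivedSeries_succ, ← Subgroup.map_subtype_commutator]
    refine ⟨?_⟩
    rw [Subgroup.index_map_subtype]
    exact mul_ne_zero hidx.index_ne_zero ih.index_ne_zero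

theorem finite_of_fg_of_derivedSeries_eq_bot [Group.FG G] (hG : IsMulTorsion G) {n : ℕ}
    (hn : derivedSeries G n = ⊥) : Finite G := by
  have := derivedSeries_finiteIndex hG n
  rw [hn] at this
  refine Nat.finite_of_card_ne_zero ?_
  rw [← Subgroup.index_bot]
  exact this.index_ne_zero

theorem derivedSeries_eq_bot_of_solvWord (h : ∀ g : ℕ ⊕ ℕ → G, FreeGroup.lift g solvWord = 1) :
    derivedSeries G 3 = ⊥ := by
  rw [eq_bot_iff]
  refine (derivedSeries_le_closure_commValues 3).trans ?_
  rw [Subgroup.closure_le]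
  rintro _ ⟨_, ⟨_, ⟨a, -, b, -, rfl⟩, _, ⟨c, -, d, -, rfl⟩, rfl⟩, _,
    ⟨_, ⟨a', -, b', -, rfl⟩, _, ⟨c', -, d', -, rfl⟩, rfl⟩, rfl⟩
  have := h (Sum.elim (fun i => if i = 1 then a else if i = 2 then b else if i = 3 then c else
    if i = 4 then d else if i = 5 then a' else if i = 6 then b' else if i = 7 then c' else d') 1)
  rw [SetLike.mem_coe, Subgroup.mem_bot]
  simpa only [solvWord, comm, map_mul, map_inv, x, FreeGroup.lift_apply_of, Sum.elim_inl, if_true,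
    Nat.reduceEqDiff, if_false, OfNat.ofNat_ne_one] using this

/-- The three checks follow the chain from `S_4` to `A_4`, the Klein four-group and the trivial
group; the Klein group appears as the even permutations of square one. -/
theorem perm_solvWord (g : ℕ ⊕ ℕ → Equiv.Perm (Fin 4)) : FreeGroup.lift g solvWord = 1 := by
  have k1 : ∀ a b : Equiv.Perm (Fin 4), Equiv.Perm.sign (a⁻¹ * b⁻¹ * a * b) = 1 := by
    decide +kernel
  have k2 : ∀ a : Equiv.Perm (Fin 4), Equiv.Perm.sign a = 1 → ∀ b : Equiv.Perm (Fin 4),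
      Equiv.Perm.sign b = 1 → Equiv.Perm.sign (a⁻¹ * b⁻¹ * a * b) = 1 ∧
        (a⁻¹ * b⁻¹ * a * b) ^ 2 = 1 := by
    decide +kernel
  have k3 : ∀ a : Equiv.Perm (Fin 4), Equiv.Perm.sign a = 1 ∧ a ^ 2 = 1 →
      ∀ b : Equiv.Perm (Fin 4), Equiv.Perm.sign b = 1 ∧ b ^ 2 = 1 → a⁻¹ * b⁻¹ * a * b = 1 := by
    decide +kernel
  simp only [solvWord, comm, map_mul, map_inv]
  exact k3 _ (k2 _ (k1 _ _) _ (k1 _ _)) _ (k2 _ (k1 _ _) _ (k1 _ _))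

theorem perm_pow_twelve (a : Equiv.Perm (Fin 4)) : a ^ 12 = 1 := by
  revert a
  decide +kernel

end FiniteGroups

/-! ### Evaluating identities and transferring them between representations -/

section Evaluation

variable {K : Type w} [Field K]

theorem asAlgebraHom_mapDomain {M G V : Type*} [Monoid M] [Monoid G] [AddCommGroup V] [Module K V]
    (ρ : Representation K G V) (φ : M →* G) (p : MonoidAlgebra K M) :
    ρ.asAlgebraHom (MonoidAlgebra.mapDomainAlgHom K K φ p) =
      MonoidAlgebra.lift K (Module.End K V) M (ρ.comp φ) p := by
  induction p using MonoidAlgebra.induction_linear with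
  | zero => simp
  | add p q hp hq => simp only [map_add, hp, hq]
  | single m r => simp [MonoidAlgebra.mapDomainAlgHom]

theorem isIdentity_iff {G V : Type*} [Group G] [AddCommGroup V] [Module K V]
    {ρ : Representation K G V} {p : MonoidAlgebra K F} :
    IsIdentity ρ p ↔ ∀ g : ℕ ⊕ ℕ → G,
      MonoidAlgebra.lift K (Module.End K V) F (MonoidHom.comp ρ (FreeGroup.lift g)) p = 0 :=
  forall_congr' fun g => by rw [asAlgebraHom_mapDomain]

theorem isIdentity_subOne_iff {G V : Type*} [Group G] [AddCommGroup V] [Module K V]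
    {ρ : Representation K G V} {f : F} :
    IsIdentity ρ (subOne K f) ↔ ∀ g : ℕ ⊕ ℕ → G, ρ (FreeGroup.lift g f) = 1 := by
  rw [isIdentity_iff]
  refine forall_congr' fun g => ?_
  rw [subOne, map_sub, MonoidAlgebra.lift_of, map_one, sub_eq_zero]
  rfl

theorem lift_starElem {A : Type*} [Ring A] [Algebra K A] (φ : F →* A) (δ : List F) :
    MonoidAlgebra.lift K A F φ (starElem K δ) =
      (δ.mapIdx fun k f => φ ((y k)⁻¹ * f * y k) - 1).prod := by
  rw [starElem, map_list_prod]
  congr 1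
  refine List.ext_getElem (by simp) fun k h₁ h₂ => ?_
  simp only [List.getElem_map, List.getElem_mapIdx, subOne, map_sub, MonoidAlgebra.lift_of,
    map_one]

theorem isIdentity_starElem_of_satisfies {G V : Type*} [Group G] [AddCommGroup V] [Module K V]
    (ρ : Representation K G V) {δ : List F} (h : Satisfies δ G) :
    IsIdentity ρ (starElem K δ) := by
  rw [isIdentity_iff]
  intro g
  obtain ⟨f, hf, h1⟩ := h g
  rw [lift_starElem]
  refine List.prod_eq_zero ?_
  obtain ⟨k, hk, rfl⟩ := List.getElem_of_mem hf
  rw [List.mem_mapIdx]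
  exact ⟨k, hk, by simp [h1]⟩

/-- Representations whose operators lie in the image of `ρ` satisfy the identities of `ρ`. -/
theorem IsIdentity.of_range {G H V : Type*} [Group G] [Group H] [AddCommGroup V] [Module K V]
    {ρ : Representation K G V} {τ : Representation K H V} (h : ∀ a, ∃ b, ρ b = τ a)
    {p : MonoidAlgebra K F} (hp : IsIdentity ρ p) : IsIdentity τ p := by
  rw [isIdentity_iff] at hp ⊢
  intro g
  choose g' hg' using fun i => h (g i)
  rw [← hp g']
  congr 2
  refine FreeGroup.ext_hom _ _ fun i => ?_
  simp [hg']

theorem lift_toRepresentation {G V : Type*} [Group G] [AddCommGroup V] [Module K V]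
    {ρ : Representation K G V} (W : Subrepresentation ρ) (φ : F →* G) (p : MonoidAlgebra K F)
    (w : W.toSubmodule) :
    (MonoidAlgebra.lift K (Module.End K W.toSubmodule) F
      (MonoidHom.comp W.toRepresentation φ) p w : V) =
      MonoidAlgebra.lift K (Module.End K V) F (MonoidHom.comp ρ φ) p w := by
  induction p using MonoidAlgebra.induction_linear with
  | zero => simp
  | add p q hp hq => simp only [map_add, LinearMap.add_apply, Submodule.coe_add, hp, hq]
  | single m r => simp [Subrepresentation.toRepresentation]

theorem IsIdentity.toRepresentation {G V : Type*} [Group G] [AddCommGroup V] [Module K V]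
    {ρ : Representation K G V} (W : Subrepresentation ρ) {p : MonoidAlgebra K F}
    (hp : IsIdentity ρ p) : IsIdentity W.toRepresentation p := by
  rw [isIdentity_iff] at hp ⊢
  intro g
  ext w
  rw [lift_toRepresentation, hp g]
  rfl

/-- An identity of the regular representation vanishes under every substitution. -/
theorem IsIdentity.mapDomain_eq_zero {G : Type*} [Group G] {p : MonoidAlgebra K F}
    (hp : IsIdentity (Representation.leftRegular K G) p) (g : ℕ ⊕ ℕ → G) :
    MonoidAlgebra.mapDomainAlgHom K K (FreeGroup.lift g) p = 0 := by
  have := congrArg (fun f => f 1) (hp g)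
  simpa only [Representation.asAlgebraHom_ofMulAction_smul_eq_mul, mul_one,
    LinearMap.zero_apply] using this

/-- A group embedding into `G` satisfies the identities of the regular representation of `G`. -/
theorem IsIdentity.of_injective {G Q V : Type*} [Group G] [Group Q] [AddCommGroup V] [Module K V]
    {p : MonoidAlgebra K F} (hp : IsIdentity (Representation.leftRegular K G) p)
    {ψ : Q →* G} (hψ : Function.Injective ψ) (σ : Representation K Q V) : IsIdentity σ p := by
  intro g
  have h0 : MonoidAlgebra.mapDomainAlgHom K K (FreeGroup.lift g) p = 0 := by
    -- The substituted element already vanishes in `KQ`, because its image in `KG` does; hence it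
    -- acts as zero in every representation of `Q`.
    apply MonoidAlgebra.mapDomain_injective (R := K) hψ
    rw [MonoidAlgebra.mapDomain_zero, ← hp.mapDomain_eq_zero (ψ ∘ g)]
    have : FreeGroup.lift (ψ ∘ g) = ψ.comp (FreeGroup.lift g) :=
      FreeGroup.ext_hom _ _ fun i => by simp
    rw [this]
    clear this hp
    induction p using MonoidAlgebra.induction_linear with
    | zero => simp
    | add p q hp hq => simp only [map_add, MonoidAlgebra.mapDomain_add, hp, hq]
    | single m r => simp [MonoidAlgebra.mapDomainAlgHom]
  rw [h0, map_zero]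

/-- Only finitely many variables occur in a word; this is what later permits replacing a
substitution by one with finitely generated image. -/
theorem exists_finset_lift_eq {G : Type*} [Group G] (f : F) : ∃ s : Finset (ℕ ⊕ ℕ),
    ∀ g g' : ℕ ⊕ ℕ → G, (∀ i ∈ s, g i = g' i) → FreeGroup.lift g f = FreeGroup.lift g' f := by
  classical
  induction f using FreeGroup.induction_on with
  | C1 => exact ⟨∅, by simp⟩
  | of i => exact ⟨{i}, by simp⟩
  | inv_of i h => exact ⟨{i}, by simp +contextual⟩
  | mul a b ha hb =>
    obtain ⟨s, hs⟩ := ha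
    obtain ⟨t, ht⟩ := hb
    refine ⟨s ∪ t, fun g g' h => ?_⟩
    rw [map_mul, map_mul, hs g g' fun i hi => h i (Finset.mem_union_left _ hi),
      ht g g' fun i hi => h i (Finset.mem_union_right _ hi)]

theorem exists_finset_mapDomain_eq {G : Type*} [Group G] (p : MonoidAlgebra K F) :
    ∃ s : Finset (ℕ ⊕ ℕ), ∀ g g' : ℕ ⊕ ℕ → G, (∀ i ∈ s, g i = g' i) →
      MonoidAlgebra.mapDomainAlgHom K K (FreeGroup.lift g) p =
        MonoidAlgebra.mapDomainAlgHom K K (FreeGroup.lift g') p := by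
  classical
  induction p using MonoidAlgebra.induction_linear with
  | zero => exact ⟨∅, by simp⟩
  | add p q hp hq =>
    obtain ⟨s, hs⟩ := hp
    obtain ⟨t, ht⟩ := hq
    refine ⟨s ∪ t, fun g g' h => ?_⟩
    rw [map_add, map_add, hs g g' fun i hi => h i (Finset.mem_union_left _ hi),
      ht g g' fun i hi => h i (Finset.mem_union_right _ hi)]
  | single f r =>
    obtain ⟨s, hs⟩ := exists_finset_lift_eq (G := G) f
    exact ⟨s, fun g g' h => by simp [MonoidAlgebra.mapDomainAlgHom, hs g g' h]⟩

end Evaluation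

/-! ### Irreducible representations: from `δ*` to `δ` -/

section Irreducible

variable {K : Type w} [Field K]

/-- On an irreducible representation, the product of the elements `f^y - 1` can vanish for all
choices of the conjugating elements only if one of the factors does. -/
theorem exists_apply_eq_one_of_prod_eq_zero {G V : Type*} [Group G] [AddCommGroup V] [Module K V]
    [Nontrivial V] (ρ : Representation K G V)
    (hρ : ∀ S : Submodule K V, (∀ g, ∀ v ∈ S, ρ g v ∈ S) → S = ⊥ ∨ S = ⊤) (l : List G)
    (h : ∀ c : ℕ → G, (l.mapIdx fun k f => ρ ((c k)⁻¹ * f * c k) - 1).prod = 0) :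
    ∃ f ∈ l, ρ f = 1 := by
  induction l with
  | nil => simp at h
  | cons f l ih =>
    by_cases hl : ∀ c : ℕ → G, (l.mapIdx fun k f => ρ ((c k)⁻¹ * f * c k) - 1).prod = 0
    · obtain ⟨f', hf', h1⟩ := ih hl
      exact ⟨f', List.mem_cons_of_mem _ hf', h1⟩
    push Not at hl
    obtain ⟨c, hc⟩ := hl
    obtain ⟨v, hv⟩ : ∃ v, (l.mapIdx fun k f => ρ ((c k)⁻¹ * f * c k) - 1).prod v ≠ 0 := by
      by_contra! hall
      exact hc (LinearMap.ext hall)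
    set v' := (l.mapIdx fun k f => ρ ((c k)⁻¹ * f * c k) - 1).prod v
    -- The conjugator of the head occurs in no other factor, so it varies freely while the tail
    -- keeps `c`, shifted by one index.
    have hfix : ∀ b : G, ρ f (ρ b v') = ρ b v' := by
      intro b
      have := h (fun k => if k = 0 then b else c (k - 1))
      rw [List.mapIdx_cons, List.prod_cons] at this
      simp only [if_true, Nat.add_eq_zero_iff, one_ne_zero, and_false, if_false,
        Nat.add_sub_cancel] at this
      have := congrArg (fun φ => ρ b (φ v)) this
      simpa [sub_eq_zero, map_mul, v'] using this
    -- The vectors whose whole orbit is fixed by `f` form an invariant subspace. It contains `v' ≠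
    -- 0`, so it is everything and `f` acts trivially.
    let S : Submodule K V := ⨅ b : G, LinearMap.ker ((ρ f - 1) ∘ₗ ρ b)
    have hS : ∀ u, u ∈ S ↔ ∀ b, ρ f (ρ b u) = ρ b u := by
      intro u
      simp [S, Submodule.mem_iInf, sub_eq_zero]
    rcases hρ S fun g u hu => (hS _).2 fun b => by
      have := (hS u).1 hu (b * g)
      simpa using this with h0 | h1
    · exact absurd ((Submodule.eq_bot_iff _).1 h0 v' ((hS _).2 hfix)) hv
    · refine ⟨f, List.mem_cons_self, LinearMap.ext fun u => ?_⟩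
      have := (hS u).1 (h1 ▸ Submodule.mem_top) 1
      simpa using this

/-- The subgroup of words in the variables `x i`. -/
def xWords : Subgroup F := (FreeGroup.map Sum.inl).range

theorem x_mem_xWords (i : ℕ) : x i ∈ xWords := ⟨FreeGroup.of i, by simp [x]⟩

theorem lift_eq_of_mem_xWords {G : Type*} [Group G] {f : F} (hf : f ∈ xWords)
    {g g' : ℕ ⊕ ℕ → G} (h : ∀ i, g (Sum.inl i) = g' (Sum.inl i)) :
    FreeGroup.lift g f = FreeGroup.lift g' f := by
  obtain ⟨f, rfl⟩ := hf
  have : (FreeGroup.lift g).comp (FreeGroup.map Sum.inl) =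
      (FreeGroup.lift g').comp (FreeGroup.map Sum.inl) :=
    FreeGroup.ext_hom _ _ fun i => by simp [h]
  exact DFunLike.congr_fun this f

/-- A faithful irreducible representation has the identity `δ*` only if the group satisfies the
disjunctive identity `δ`. -/
theorem satisfies_of_isIdentity_starElem {G V : Type*} [Group G] [AddCommGroup V] [Module K V]
    [Nontrivial V] {ρ : Representation K G V} (hinj : Function.Injective ρ)
    (hρ : ∀ S : Submodule K V, (∀ g, ∀ v ∈ S, ρ g v ∈ S) → S = ⊥ ∨ S = ⊤) {δ : List F}
    (hδ : ∀ f ∈ δ, f ∈ xWords) (h : IsIdentity ρ (starElem K δ)) : Satisfies δ G := by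
  intro g
  obtain ⟨f', hf', h1⟩ := exists_apply_eq_one_of_prod_eq_zero ρ hρ (δ.map (FreeGroup.lift g))
    (by
      intro c
      -- The `y` variables can be reassigned to `c` because the words of `δ` do not contain them.
      have := isIdentity_iff.1 h (Sum.elim (fun i => g (Sum.inl i)) c)
      rw [lift_starElem] at this
      rw [← this]
      congr 1
      refine List.ext_getElem (by simp) fun k h₁ h₂ => ?_
      have hk : k < δ.length := by simpa using h₁
      have := lift_eq_of_mem_xWords (hδ _ (List.getElem_mem hk))
        (g := g) (g' := Sum.elim (fun i => g (Sum.inl i)) c) fun i => rfl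
      simp [this, y])
  obtain ⟨f, hf, rfl⟩ := List.mem_map.1 hf'
  exact ⟨f, hf, hinj (by rw [h1, map_one])⟩

theorem memPowers_subset_xWords {a b : F} (ha : a ∈ xWords) (hb : b ∈ xWords) :
    ∀ f ∈ memPowers a b, f ∈ xWords := by
  simp only [memPowers, List.forall_mem_cons]
  exact ⟨ha, mul_mem ha (inv_mem hb), mul_mem ha (inv_mem (pow_mem hb 2)),
    mul_mem ha (inv_mem (pow_mem hb 3)), by simp⟩

theorem omega_subset_xWords (n : ℕ) : ∀ f ∈ omega n, f ∈ xWords := by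
  intro f hf
  obtain ⟨i, j, -, -, rfl⟩ := mem_omega.1 hf
  exact mul_mem (x_mem_xWords i) (inv_mem (x_mem_xWords j))

theorem delta10_subset_xWords : ∀ f ∈ delta10, f ∈ xWords := by
  have h1 := x_mem_xWords 1
  have h2 := x_mem_xWords 2
  simp only [delta10, List.forall_mem_cons]
  exact ⟨pow_mem h1 4, pow_mem h2 4, pow_mem (mul_mem h1 h2) 4,
    pow_mem (mul_mem h1 (pow_mem h2 2)) 4, by simp⟩

theorem delta11_subset_xWords : ∀ f ∈ delta11, f ∈ xWords := by
  simp [delta11, x_mem_xWords, pow_mem]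

theorem delta12_subset_xWords : ∀ f ∈ delta12, f ∈ xWords := by
  simp [delta12, x_mem_xWords, mul_mem, pow_mem]

theorem delta13_subset_xWords : ∀ f ∈ delta13, f ∈ xWords := by
  intro f hf
  simp only [delta13, theta, List.mem_append, List.mem_flatMap] at hf
  rcases hf with hf | (⟨⟨i, j⟩, -, hf⟩ | ⟨⟨i, j, k⟩, -, hf⟩) | ⟨⟨i, j, k⟩, -, hf⟩
  · revert f
    simp [x_mem_xWords, mul_mem, pow_mem]
  · exact memPowers_subset_xWords (x_mem_xWords _) (x_mem_xWords _) f hf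
  · exact memPowers_subset_xWords (x_mem_xWords _) (mul_mem (x_mem_xWords _) (x_mem_xWords _)) f hf
  · exact memPowers_subset_xWords (mul_mem (x_mem_xWords _) (x_mem_xWords _))
      (mul_mem (x_mem_xWords _) (x_mem_xWords _)) f hf

/-- The tautological representation of a group of invertible linear maps. -/
def unitsRep {V : Type*} [AddCommGroup V] [Module K V] (H : Subgroup (Module.End K V)ˣ) :
    Representation K H V :=
  (Units.coeHom _).comp H.subtype

theorem unitsRep_injective {V : Type*} [AddCommGroup V] [Module K V]
    (H : Subgroup (Module.End K V)ˣ) : Function.Injective (unitsRep H) :=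
  Units.val_injective.comp Subtype.val_injective

/-- A faithful irreducible representation of a finite group in the variety defined by `basisS4`
has all identities of the regular representation of `S_4`. -/
theorem isIdentity_of_faithful_irreducible {G V : Type*} [Group G] [Finite G] [AddCommGroup V]
    [Module K V] [Nontrivial V] {ρ : Representation K G V} (hinj : Function.Injective ρ)
    (hρ : ∀ S : Submodule K V, (∀ g, ∀ v ∈ S, ρ g v ∈ S) → S = ⊥ ∨ S = ⊤)
    (hU : InVariety (basisS4 K) ρ) {p : MonoidAlgebra K F}
    (hp : IsIdentity (Representation.leftRegular K (Equiv.Perm (Fin 4))) p) :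
    IsIdentity ρ p := by
  have hsat := fun {δ : List F} => satisfies_of_isIdentity_starElem (δ := δ) hinj hρ
  obtain ⟨ψ, hψ⟩ := exists_embedding_of_satisfies
    (hsat (omega_subset_xWords 24) (hU _ (by simp [basisS4])))
    (hsat delta10_subset_xWords (hU _ (by simp [basisS4])))
    (hsat delta11_subset_xWords (hU _ (by simp [basisS4])))
    (hsat delta12_subset_xWords (hU _ (by simp [basisS4])))
    (hsat delta13_subset_xWords (hU _ (by simp [basisS4])))
  exact hp.of_injective hψ ρ

/-- Identities and invariant subspaces depend only on the group of operators, so `G` may be replaced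
by its image, which acts faithfully. -/
theorem isIdentity_of_irreducible {G V : Type*} [Group G] [Finite G] [AddCommGroup V]
    [Module K V] [Nontrivial V] {ρ : Representation K G V}
    (hρ : ∀ S : Submodule K V, (∀ g, ∀ v ∈ S, ρ g v ∈ S) → S = ⊥ ∨ S = ⊤)
    (hU : InVariety (basisS4 K) ρ) {p : MonoidAlgebra K F}
    (hp : IsIdentity (Representation.leftRegular K (Equiv.Perm (Fin 4))) p) :
    IsIdentity ρ p := by
  let H := ρ.asGroupHom.range
  have hH : ∀ a : H, ∃ b, ρ b = unitsRep H a := by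
    rintro ⟨_, b, rfl⟩
    exact ⟨b, (ρ.asGroupHom_apply b).symm⟩
  have hH' : ∀ b : G, ∃ a : H, unitsRep H a = ρ b := fun b =>
    ⟨⟨_, b, rfl⟩, ρ.asGroupHom_apply b⟩
  have : Finite H := Finite.of_surjective _ ρ.asGroupHom.rangeRestrict_surjective
  refine IsIdentity.of_range hH' ?_
  refine isIdentity_of_faithful_irreducible (unitsRep_injective H) (fun S hS => hρ S ?_)
    (fun q hq => (hU q hq).of_range hH) hp
  intro g v hv
  obtain ⟨a, ha⟩ := hH' g
  exact ha ▸ hS a v hv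

end Irreducible

/-! ### Reduction of the general case to irreducible representations -/

section Semisimple

variable {K : Type w} [Field K]

/-- An identity of all irreducible subrepresentations of a semisimple representation is an identity
of the representation. -/
theorem isIdentity_of_isAtom {G V : Type*} [Group G] [AddCommGroup V] [Module K V]
    {ρ : Representation K G V} [ρ.IsSemisimpleRepresentation] {p : MonoidAlgebra K F}
    (h : ∀ W : Subrepresentation ρ, IsAtom W → IsIdentity W.toRepresentation p) :
    IsIdentity ρ p := by
  have : IsSemisimpleModule (MonoidAlgebra K G) ρ.asModule :=
    ρ.isSemisimpleRepresentation_iff_isSemisimpleModule_asModule.1 inferInstance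
  rw [isIdentity_iff]
  intro g
  ext v
  have hv : ρ.asModuleEquiv.symm v ∈ sSup {W : Submodule (MonoidAlgebra K G) ρ.asModule |
      IsSimpleModule (MonoidAlgebra K G) W} := by
    rw [IsSemisimpleModule.sSup_simples_eq_top]
    trivial
  rw [sSup_eq_iSup'] at hv
  suffices hs : ∀ m : ρ.asModule, m ∈ (⨆ W : {W : Submodule (MonoidAlgebra K G) ρ.asModule |
      IsSimpleModule (MonoidAlgebra K G) W}, W.1) →
      MonoidAlgebra.lift K (Module.End K V) F (MonoidHom.comp ρ (FreeGroup.lift g)) p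
        (ρ.asModuleEquiv m) = 0 by
    simpa using hs _ hv
  intro m hm
  induction hm using Submodule.iSup_induction' with
  | zero => simp
  | add a b _ _ ha hb => simp only [map_add, ha, hb, add_zero]
  | mem W m hm =>
    obtain ⟨W, hW⟩ := W
    have hatom : IsAtom (Subrepresentation.ofSubmodule' W) := by
      have := isSimpleModule_iff_isAtom.1 hW
      exact (OrderIso.isAtom_iff
        (Subrepresentation.subrepresentationSubmoduleOrderIso (ρ := ρ)).symm W).2 this
    have h0 := isIdentity_iff.1 (h _ hatom) g
    have h1 := lift_toRepresentation (Subrepresentation.ofSubmodule' W) (FreeGroup.lift g) p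
      ⟨ρ.asModuleEquiv m, hm⟩
    rw [h0] at h1
    exact h1.symm

theorem eq_bot_or_eq_top_of_isAtom {G V : Type*} [Group G] [AddCommGroup V] [Module K V]
    {ρ : Representation K G V} {W : Subrepresentation ρ} (hW : IsAtom W)
    (S : Submodule K W.toSubmodule) (hS : ∀ g, ∀ v ∈ S, W.toRepresentation g v ∈ S) :
    S = ⊥ ∨ S = ⊤ := by
  let S' : Subrepresentation ρ := ⟨S.map W.toSubmodule.subtype, by
    rintro g _ ⟨v, hv, rfl⟩
    exact ⟨_, hS g v hv, rfl⟩⟩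
  have hle : S' ≤ W := by
    rintro _ ⟨v, -, rfl⟩
    exact v.2
  rcases hW.le_iff.1 hle with h | h
  · left
    have : S.map W.toSubmodule.subtype = ⊥ := congrArg Subrepresentation.toSubmodule h
    exact Submodule.map_injective_of_injective W.toSubmodule.subtype_injective
      (this.trans (Submodule.map_bot _).symm)
  · right
    rw [eq_top_iff]
    intro v _
    have hv : (v : V) ∈ S' := by rw [h]; exact v.2
    obtain ⟨v', hv', he⟩ := hv
    rwa [← Subtype.ext he]

theorem nontrivial_of_isAtom {G V : Type*} [Group G] [AddCommGroup V] [Module K V]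
    {ρ : Representation K G V} {W : Subrepresentation ρ} (hW : IsAtom W) :
    Nontrivial W.toSubmodule := by
  rw [Submodule.nontrivial_iff_ne_bot]
  intro h
  exact hW.1 (Subrepresentation.toSubmodule_injective h)

/-- The order of a finite group of exponent dividing `12` is invertible in a field of
characteristic different from `2` and `3`. -/
theorem card_cast_ne_zero (h2 : ringChar K ≠ 2) (h3 : ringChar K ≠ 3) (G : Type*) [Group G]
    [Finite G] (h12 : ∀ g : G, g ^ 12 = 1) : (Nat.card G : K) ≠ 0 := by
  intro h0
  have hdvd : ringChar K ∣ Nat.card G := (ringChar.spec K _).1 h0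
  have hp : (ringChar K).Prime := (CharP.char_is_prime_or_zero K (ringChar K)).resolve_right
    fun h => Nat.card_pos.ne' (Nat.eq_zero_of_zero_dvd (h ▸ hdvd))
  have : Fact (ringChar K).Prime := ⟨hp⟩
  obtain ⟨g, hg⟩ := exists_prime_orderOf_dvd_card' _ hdvd
  have hd : ringChar K ∣ 2 ^ 2 * 3 := hg ▸ orderOf_dvd_of_pow_eq_one (h12 g)
  rcases hp.dvd_mul.1 hd with h | h
  · exact h2 ((Nat.prime_dvd_prime_iff_eq hp Nat.prime_two).1 (hp.dvd_of_dvd_pow h))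
  · exact h3 ((Nat.prime_dvd_prime_iff_eq hp Nat.prime_three).1 h)

/-- Maschke's theorem, available through the `NeZero` instance, makes `ρ` semisimple, and its
irreducible subrepresentations inherit the given identities. -/
theorem isIdentity_of_finite (h2 : ringChar K ≠ 2) (h3 : ringChar K ≠ 3) {G V : Type*} [Group G]
    [Finite G] (h12 : ∀ g : G, g ^ 12 = 1) [AddCommGroup V] [Module K V]
    {ρ : Representation K G V} (hU : InVariety (basisS4 K) ρ) {p : MonoidAlgebra K F}
    (hp : IsIdentity (Representation.leftRegular K (Equiv.Perm (Fin 4))) p) :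
    IsIdentity ρ p := by
  have : NeZero (Nat.card G : K) := ⟨card_cast_ne_zero h2 h3 G h12⟩
  refine isIdentity_of_isAtom fun W hW => ?_
  have := nontrivial_of_isAtom hW
  exact isIdentity_of_irreducible (eq_bot_or_eq_top_of_isAtom hW)
    (fun q hq => (hU q hq).toRepresentation W) hp

theorem isIdentity_of_inVariety (h2 : ringChar K ≠ 2) (h3 : ringChar K ≠ 3) {G V : Type*}
    [Group G] [AddCommGroup V] [Module K V] {ρ : Representation K G V}
    (hU : InVariety (basisS4 K) ρ) {p : MonoidAlgebra K F}
    (hp : IsIdentity (Representation.leftRegular K (Equiv.Perm (Fin 4))) p) :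
    IsIdentity ρ p := by
  classical
  intro g
  obtain ⟨s, hs⟩ := exists_finset_mapDomain_eq (G := G) p
  rw [hs g (fun i => if i ∈ s then g i else 1) fun i hi => by simp [hi]]
  -- Variables outside `s` do not affect `p`; sending them to 1 leaves finitely many generators.
  set g' : ℕ ⊕ ℕ → G := fun i => if i ∈ s then g i else 1
  have hrange : (Set.range fun i => ρ.asGroupHom (g' i)).Finite := by
    refine ((s.image fun i => ρ.asGroupHom (g i)) ∪ {1}).finite_toSet.subset ?_
    rintro _ ⟨i, rfl⟩
    by_cases hi : i ∈ s
    · exact Finset.mem_coe.2 (Finset.mem_union_left _ (Finset.mem_image.2 ⟨i, hi, by simp [g', hi]⟩))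
    · simp [g', hi]
  -- The subgroup is taken among operators rather than in `G`: the identities `x^12 - 1` and
  -- `solvWord - 1` constrain only the image of `ρ`.
  let H : Subgroup (Module.End K V)ˣ := Subgroup.closure (Set.range fun i => ρ.asGroupHom (g' i))
  have hle : H ≤ ρ.asGroupHom.range := by
    rw [Subgroup.closure_le]
    rintro _ ⟨i, rfl⟩
    exact ⟨_, rfl⟩
  have hH : ∀ a : H, ∃ b, ρ b = unitsRep H a := by
    rintro ⟨a, ha⟩
    obtain ⟨b, rfl⟩ := hle ha
    exact ⟨b, (ρ.asGroupHom_apply b).symm⟩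
  have hUH : InVariety (basisS4 K) (unitsRep H) := fun q hq => (hU q hq).of_range hH
  have h12 : ∀ a : H, a ^ 12 = 1 := by
    intro a
    have := isIdentity_subOne_iff.1 (hUH (subOne K (x 1 ^ 12)) (by simp [basisS4])) fun _ => a
    refine unitsRep_injective H ?_
    simpa [x] using this
  have hsolv : ∀ a : ℕ ⊕ ℕ → H, FreeGroup.lift a solvWord = 1 := by
    intro a
    refine unitsRep_injective H ?_
    rw [map_one]
    exact isIdentity_subOne_iff.1 (hUH (subOne K solvWord) (by simp [basisS4])) a
  have : Group.FG H := by
    rw [Group.fg_iff_subgroup_fg]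
    exact (Subgroup.fg_iff _).2 ⟨_, rfl, hrange⟩
  have : Finite H := finite_of_fg_of_derivedSeries_eq_bot
    (fun a => isOfFinOrder_iff_pow_eq_one.2 ⟨12, by norm_num, h12 a⟩)
    (derivedSeries_eq_bot_of_solvWord hsolv)
  have := isIdentity_iff.1 (isIdentity_of_finite h2 h3 h12 hUH hp)
    fun i => ⟨ρ.asGroupHom (g' i), Subgroup.subset_closure ⟨i, rfl⟩⟩
  rw [asAlgebraHom_mapDomain, ← this]
  congr 2
  refine FreeGroup.ext_hom _ _ fun i => ?_
  simp [unitsRep, Representation.asGroupHom_apply]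

theorem basisS4_subset_identities :
    basisS4 K ⊆ identities (Representation.leftRegular K (Equiv.Perm (Fin 4))) := by
  have hstar := fun (δ : List F) => isIdentity_starElem_of_satisfies (δ := δ)
    (Representation.leftRegular K (Equiv.Perm (Fin 4)))
  intro p hp
  simp only [basisS4, Set.mem_insert_iff, Set.mem_singleton_iff] at hp
  rcases hp with hp | hp | hp | hp | hp | hp | hp <;> rw [hp]
  · exact hstar _ perm_satisfies_omega
  · exact hstar _ perm_satisfies_delta10
  · exact hstar _ perm_satisfies_delta11
  · exact hstar _ perm_satisfies_delta12
  · exact hstar _ perm_satisfies_delta13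
  · refine isIdentity_subOne_iff.2 fun g => ?_
    rw [map_pow, perm_pow_twelve, map_one]
  · refine isIdentity_subOne_iff.2 fun g => ?_
    rw [perm_solvWord, map_one]

end Semisimple

end RegIdentities

theorem proposition6 (K : Type w) [Field K] (h2 : ringChar K ≠ 2) (h3 : ringChar K ≠ 3) :
    RegIdentities.IsBasisOfIdentities.{u, v, w, 0, w} (RegIdentities.basisS4 K)
      (Representation.leftRegular K (Equiv.Perm (Fin 4))) := by
  refine ⟨RegIdentities.basisS4_subset_identities, fun G V _ _ _ ρ => ⟨fun h p hp => ?_,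
    fun h p hp => h p (RegIdentities.basisS4_subset_identities hp)⟩⟩
  exact RegIdentities.isIdentity_of_inVariety h2 h3 h hp
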